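/- **Setting.** Let $S$ (skills) and $T$ (text pieces) be finite sets with probability measures $\mu_1$ on $S$ and $\mu_2$ on $T$. In the random degree-$k$ skill graph, every $t\in T$ receives $k$ skills $G(t,1),\dots,G(t,k)$, all draws (over all $t$ and $i$) being independent with law $\mu_1$; the edges are the pairs $(t,i)$, joining $t$ to $G(t,i)$ (so they are counted with multiplicity), and an edge at $t$ has measure $\mu_2(t)$. More generally, consider a bipartite multigraph from a probability space $(V,\mu)$ to a probability space $(W,\nu)$ in which every $v\in V$ has $d$ edges of measure $\mu(v)$, and let $Y\subseteq V$. We say that $w\in W$ *sends at most a fraction $c$ of its edges into $Y$* if the total measure of the edges between $w$ and $Y$ is at most $c$ times the total measure of all edges at $w$, and also at most $c$ times its expected value $d\,\nu(w)$. For $k'\ge 1$, a *$k'$-wise recombination* is a partition of $T$ into blocks of size $k'$, each an ordered $k'$-tuple $(t_1,\dots,t_{k'})$ of text pieces, called a $k'$-piece. A $k'$-piece has measure $\mu_2(t_1)+\dots+\mu_2(t_{k'})$ and carries the $k'k$ skills $G(t_j,i)$. The set $S^{k'}$ of $k'$-tuples of skills carries the product measure $\mu_1^{\otimes k'}$. Consider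 the following graphs between $k'$-pieces and $k'$-tuples of skills: (a) for each bijection $g$ from $\{1,\dots,k\}\times\{1,\dots,k'\}$ to $\{1,\dots,k'\}\times\{1,\dots,k\}$, the degree-$k$ graph in which the $k'k$ skills of every $k'$-piece are arranged according to $g$ into $k$ disjoint $k'$-tuples, to which it is joined; (b) the graph in which every $k'$-piece is joined to every $k'$-tuple of skills it uses, with one edge for each ordered choice of $k'$ distinct positions among its $k'k$ skills. **Theorem (Emergence of skills and $k'$-tuples of skills).** Let $k\ge 1$ be an integer, $\theta\in[0,1]$, $\alpha>0$, $\beta>1$, $\alpha\beta<1$, let $H(x)=x\log\frac1x+(1-x)\log\frac1{1-x}$ be the binary entropy function, and assume $$H(\theta)+k\theta\Bigl(H(\beta\alpha)-\beta\alpha\log\frac1\alpha-(1-\beta\alpha)\log\frac1{1-\alpha}\Bigr)<0 .$$ 1. For every $\varepsilon>0$ there is $\delta>0$, depending only on $k,\theta,\alpha,\beta,\varepsilon$, such that for all $S,T,\mu_1,\mu_2$ as above with $|S|\,\mu_2(t)\le\delta$ for every $t\in T$, the following holds with probability at least $1-\varepsilon$ in the random degree-$k$ skill graph: for every $Y\subseteq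 T$ with $\mu_2(Y)\le\theta$, the skills that send at most a $\beta\theta$ fraction of their edges into $Y$ have total $\mu_1$-measure at least $1-\alpha$. 2. For every $k'\ge 1$ and $\varepsilon>0$ there is $\delta>0$, depending only on $k,k',\theta,\alpha,\beta,\varepsilon$, such that for all $S,T,\mu_1,\mu_2$ as above with $|S|^{k'}\mu_2(t)\le\delta$ for every $t\in T$, and every $k'$-wise recombination of $T$ that is fixed before the graph is drawn (hence also for a random one independent of the graph), the following holds with probability at least $1-\varepsilon$, simultaneously for all the graphs in (a) and (b): for every set $Y$ of $k'$-pieces of total measure at most $\theta$, the $k'$-tuples of skills that send at most a $\beta\theta$ fraction of their edges into $Y$ have total $\mu_1^{\otimes k'}$-measure at least $1-\alpha$. -/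

import Mathlib

open MeasureTheory

noncomputable section

/-- The law of the random degree-`k` bipartite skill graph: every text piece `t : T` receives `k`
skills `G t 0, …, G t (k-1)`, all draws being independent with law `μ₁` (with replacement, so
`G` is a bipartite multigraph whose edges are the pairs `(t, i)`, joining `t` to `G t i`). -/
def skillGraphLaw {S : Type*} [MeasurableSpace S] (T : Type*) [Fintype T] (k : ℕ)
    (μ₁ : Measure S) : Measure (T → Fin k → S) :=
  Measure.pi fun _ : T => Measure.pi fun _ : Fin k => μ₁

open Classical in
/-- In a bipartite multigraph in which `t : V` has the neighbours `nbr t i`, `i : I`, and in which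
each edge at `t` carries the measure `μ {t}`: the total measure of the edges that join `w`
to the set `Y`. -/
def edgeMass {V W I : Type*} [MeasurableSpace V] [Fintype I] (μ : Measure V)
    (nbr : V → I → W) (Y : Finset V) (w : W) : ℝ :=
  ∑ t ∈ Y, ∑ i : I, if nbr t i = w then μ.real {t} else 0

/-- The vertices `w` that send at most a `c` fraction of their edges (by measure) into `Y`: at most
`c` times the total measure of the edges at `w`, and also at most `c` times the expected total
measure `|I| * ν {w}` of the edges at `w` (when all neighbours have law `ν` and `μ` is a
probability measure). -/
def lowExposure {V W I : Type*} [MeasurableSpace V] [MeasurableSpace W] [Fintype V] [Fintype I]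
    (μ : Measure V) (ν : Measure W) (nbr : V → I → W) (c : ℝ) (Y : Finset V) : Set W :=
  {w | edgeMass μ nbr Y w ≤ c * edgeMass μ nbr Finset.univ w ∧
       edgeMass μ nbr Y w ≤ c * (Fintype.card I * ν.real {w})}

/-- For every set `Y` of measure at most `θ`, the vertices that send at most a `β * θ` fraction of
their edges into `Y` have total measure at least `1 - α`. -/
def SkillsEmerge {V W I : Type*} [MeasurableSpace V] [MeasurableSpace W] [Fintype V] [Fintype I]
    (μ : Measure V) (ν : Measure W) (nbr : V → I → W) (θ α β : ℝ) : Prop :=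
  ∀ Y : Finset V, μ.real (Y : Set V) ≤ θ → 1 - α ≤ ν.real (lowExposure μ ν nbr (β * θ) Y)

/-- A `k'`-wise recombination `e` partitions the text pieces into `m` blocks of size `k'`;
block `p` is the `k'`-piece formed by the text pieces `e.symm (p, j)`. Its measure is the
sum of the measures of these text pieces. -/
def pieceMeasure {T : Type*} [MeasurableSpace T] {m k' : ℕ} (e : T ≃ Fin m × Fin k')
    (μ₂ : Measure T) : Measure (Fin m) :=
  μ₂.map fun t => (e t).1

/-- The `k' * k` skills of the `k'`-piece `p`. -/
def pieceSkills {S T : Type*} {m k k' : ℕ} (e : T ≃ Fin m × Fin k') (G : T → Fin k → S)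
    (p : Fin m) (x : Fin k' × Fin k) : S :=
  G (e.symm (p, x.1)) x.2

/-- The degree-`k` graph between `k'`-pieces and `k'`-tuples of skills in which the `k' * k` skills
of each `k'`-piece are arranged, by the pattern `g`, into `k` disjoint `k'`-tuples. -/
def groupedTuples {S T : Type*} {m k k' : ℕ} (e : T ≃ Fin m × Fin k')
    (g : Fin k × Fin k' ≃ Fin k' × Fin k) (G : T → Fin k → S) :
    Fin m → Fin k → (Fin k' → S) :=
  fun p i j => pieceSkills e G p (g (i, j))

/-- The graph between `k'`-pieces and `k'`-tuples of skills in which a `k'`-piece is joined to every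
`k'`-tuple of skills that it uses, one edge for each choice of `k'` distinct ordered positions among
its `k' * k` skills. -/
def usedTuples {S T : Type*} {m k k' : ℕ} (e : T ≃ Fin m × Fin k') (G : T → Fin k → S) :
    Fin m → (Fin k' ↪ Fin k' × Fin k) → (Fin k' → S) :=
  fun p f j => pieceSkills e G p (f j)

end

/-! A union bound over all sets `Y` of text pieces is replaced by one over the sets `B` of skills
only, which is why `|S| * μ₂ {t}` has to be small. For fixed `B` of measure at least `α`, let `X v`
be the number of edges from `v` into `B`, scaled by `α / ν B`. For every `Y` of measure at most `θ`
and every level `lam`, the `X`-mass of `Y` is at most `lam * θ` plus the mean of a convex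
exponential majorant of `(X - lam)⁺` (`sum_mul_le_add_sum_exp`). This bound no longer involves `Y`
and is a weighted sum of independent bounded variables, so Hoeffding's inequality and a union bound
over `B` apply (`exists_measureReal_iUnion_le`).

With the best `lam`, its expectation is at most `θ * (k * log (1 + α * (exp s - 1)) - log θ) / s`.
The bracket multiplying `k * θ` in the entropy condition is minus the relative entropy of
Bernoulli(`βα`) to Bernoulli(`α`), so the Chernoff-optimal `s` brings this below `k * β * θ * α`.

Together with a lower bound for the edges at every `B`, this gives `WellMixed`, which
deterministically implies `SkillsEmerge`. For tuples, each grouped graph is itself a random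
degree-`k` graph, and the graph of used tuples is an average of grouped graphs. -/

/-! ### Concentration of weighted sums -/

theorem measureReal_pi_integral_add_le_sum_le {V Ω : Type*} [Fintype V] [MeasurableSpace Ω]
    (P : Measure Ω) [IsProbabilityMeasure P] {F : Ω → ℝ} (hF : Measurable F) {C : ℝ}
    (hFC : ∀ x, F x ∈ Set.Icc 0 C) (hC : 0 < C) {p : V → ℝ} (hp : ∀ v, 0 ≤ p v)
    (hp1 : ∑ v, p v = 1) {q : ℝ} (hpq : ∀ v, p v ≤ q) {τ : ℝ} (hτ : 0 < τ) :
    (Measure.pi fun _ : V => P).real {x | ∫ y, F y ∂P + τ ≤ ∑ v, p v * F (x v)} ≤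
      Real.exp (-(2 * τ ^ 2 / (C ^ 2 * q))) := by
  classical
  set X : V → (V → Ω) → ℝ := fun v x => p v * F (x v) - p v * ∫ y, F y ∂P with hX
  have hint : ∀ v, ∫ x, p v * F (x v) ∂(Measure.pi fun _ : V => P) = p v * ∫ y, F y ∂P := by
    intro v
    rw [integral_const_mul]
    congr 1
    have := (measurePreserving_eval (fun _ : V => P) v)
    have h := integral_map (μ := Measure.pi fun _ : V => P) this.measurable.aemeasurable
      (f := F) hF.aestronglyMeasurable
    rw [this.map_eq] at h
    exact h.symm
  have hind : ProbabilityTheory.iIndepFun X (Measure.pi fun _ : V => P) :=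
    ProbabilityTheory.iIndepFun_pi
      (X := fun v y => p v * F y - p v * ∫ y, F y ∂P)
      fun v => ((hF.const_mul _).sub_const _).aemeasurable
  have hsub : ∀ v ∈ (Finset.univ : Finset V),
      ProbabilityTheory.HasSubgaussianMGF (X v) ((‖p v * C - 0‖₊ / 2) ^ 2)
        (Measure.pi fun _ : V => P) := by
    intro v _
    have := ProbabilityTheory.hasSubgaussianMGF_of_mem_Icc (μ := Measure.pi fun _ : V => P)
      (X := fun x : V → Ω => p v * F (x v)) (a := 0) (b := p v * C)
      ((hF.comp (measurable_pi_apply v)).const_mul _).aemeasurable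
      (Filter.Eventually.of_forall fun x =>
        ⟨mul_nonneg (hp v) (hFC _).1, mul_le_mul_of_nonneg_left (hFC _).2 (hp v)⟩)
    simpa only [hint] using this
  have key := ProbabilityTheory.HasSubgaussianMGF.measure_sum_ge_le_of_iIndepFun hind hsub hτ.le
  have hset : {x : V → Ω | ∫ y, F y ∂P + τ ≤ ∑ v, p v * F (x v)} =
      {x | τ ≤ ∑ v, X v x} := by
    ext x
    simp only [hX, Set.mem_ofPred_eq, Finset.sum_sub_distrib, ← Finset.sum_mul, hp1, one_mul]
    constructor <;> intro h <;> linarith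
  rw [hset]
  refine key.trans (Real.exp_le_exp.2 ?_)
  have hc : ((∑ v, (‖p v * C - 0‖₊ / 2) ^ 2 : NNReal) : ℝ) = C ^ 2 / 4 * ∑ v, p v ^ 2 := by
    push_cast
    rw [Finset.mul_sum]
    refine Finset.sum_congr rfl fun v _ => ?_
    rw [sub_zero, Real.norm_eq_abs, div_pow, sq_abs]
    ring
  -- Small individual weights force a small total variance proxy.
  have hsq : ∑ v, p v ^ 2 ≤ q := by
    calc ∑ v, p v ^ 2 ≤ ∑ v, q * p v :=
          Finset.sum_le_sum fun v _ => by
            rw [pow_two]; exact mul_le_mul_of_nonneg_right (hpq v) (hp v)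
      _ = q := by rw [← Finset.mul_sum, hp1, mul_one]
  have hpos : 0 < ∑ v, p v ^ 2 := by
    obtain ⟨v, hv⟩ : ∃ v, p v ≠ 0 := by
      by_contra! h
      simp [h] at hp1
    exact Finset.sum_pos' (fun v _ => sq_nonneg _) ⟨v, Finset.mem_univ _, by positivity⟩
  rw [hc, neg_div]
  have : 2 * τ ^ 2 / (C ^ 2 * q) ≤ τ ^ 2 / (2 * (C ^ 2 / 4 * ∑ v, p v ^ 2)) := by
    rw [div_le_div_iff₀ (mul_pos (by positivity) (hpos.trans_le hsq)) (by positivity)]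
    have h0 : 0 ≤ τ ^ 2 * C ^ 2 := by positivity
    nlinarith [mul_le_mul_of_nonneg_left hsq h0]
  linarith

/-- Uniform deviation bound: a family of bounded statistics that is indexed by the subsets of a
finite type `W` deviates nowhere, if all weights are small compared with `1 / |W|`. -/
theorem exists_measureReal_iUnion_le {C τ ε : ℝ} (hC : 0 < C) (hτ : 0 < τ) (hε : 0 < ε) :
    ∃ δ : ℝ, 0 < δ ∧ ∀ {V W Ω : Type*} [Fintype V] [Fintype W] [Nonempty W] [MeasurableSpace Ω]
      (P : Measure Ω) [IsProbabilityMeasure P] (F : Finset W → Ω → ℝ)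
      (_ : ∀ B, Measurable (F B)) (_ : ∀ B x, F B x ∈ Set.Icc 0 C) (p : V → ℝ)
      (_ : ∀ v, 0 ≤ p v) (_ : ∑ v, p v = 1) (_ : ∀ v, Fintype.card W * p v ≤ δ),
      (Measure.pi fun _ : V => P).real
        (⋃ B, {x | ∫ y, F B y ∂P + τ ≤ ∑ v, p v * F B (x v)}) ≤ ε := by
  classical
  set L : ℝ := 1 / ε with hL
  have hL0 : 0 < L := by positivity
  -- Chosen so that each Hoeffding bound is `exp (-N * (1 + L))` with `N = |W|`: one factor `exp
  -- (-N)` absorbs the `2 ^ N` sets, and the rest is at most `exp (-1 / ε) ≤ ε`.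
  refine ⟨2 * τ ^ 2 / (C ^ 2 * (1 + L)), by positivity, ?_⟩
  intro V W Ω _ _ _ _ P _ F hF hFC p hp hp1 hpq
  set N : ℝ := (Fintype.card W : ℝ) with hN
  have hN1 : 1 ≤ N := Nat.one_le_cast.2 (Fintype.card_pos (α := W))
  have hN0 : 0 < N := by linarith
  have hq : ∀ v, p v ≤ 2 * τ ^ 2 / (C ^ 2 * (1 + L)) / N := fun v => by
    rw [le_div_iff₀ hN0, mul_comm]; exact hpq v
  calc (Measure.pi fun _ : V => P).real
        (⋃ B, {x | ∫ y, F B y ∂P + τ ≤ ∑ v, p v * F B (x v)})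
      ≤ ∑ B : Finset W, (Measure.pi fun _ : V => P).real
          {x | ∫ y, F B y ∂P + τ ≤ ∑ v, p v * F B (x v)} := measureReal_iUnion_fintype_le _
    _ ≤ ∑ _B : Finset W, Real.exp (-(N * (1 + L))) := by
        refine Finset.sum_le_sum fun B _ => ?_
        refine (measureReal_pi_integral_add_le_sum_le P (hF B) (hFC B) hC hp hp1 hq hτ).trans
          (le_of_eq ?_)
        congr 2
        field_simp
    _ = 2 ^ Fintype.card W * Real.exp (-(N * (1 + L))) := by
        simp [Finset.sum_const, Fintype.card_finset]
    _ ≤ Real.exp N * Real.exp (-(N * (1 + L))) := by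
        gcongr
        rw [hN, ← mul_one (Fintype.card W : ℝ), Real.exp_nat_mul]
        gcongr
        linarith [Real.add_one_le_exp (1 : ℝ)]
    _ = Real.exp (-(N * L)) := by rw [← Real.exp_add]; congr 1; ring
    _ ≤ Real.exp (-L) := Real.exp_le_exp.2 (by nlinarith)
    _ ≤ ε := by
        rw [Real.exp_neg, inv_le_comm₀ (Real.exp_pos _) hε, ← one_div, ← hL]
        linarith [Real.add_one_le_exp L]

/-! ### Knapsack bound and entropy exponent -/

/-- Fractional knapsack bound for the heaviest part of measure at most `θ`. -/
theorem sum_mul_le_add_sum_exp {V : Type*} [Fintype V] {p X : V → ℝ} (hp : ∀ v, 0 ≤ p v)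
    (hp1 : ∑ v, p v = 1) (hX : ∀ v, 0 ≤ X v) {θ s : ℝ} (lam : ℝ) (hθ : θ ≤ 1) (hs : 0 < s)
    {Y : Finset V} (hY : ∑ v ∈ Y, p v ≤ θ) :
    ∑ v ∈ Y, p v * X v ≤
      lam * θ + ∑ v, p v * (s⁻¹ * Real.exp (s * (X v - lam) - 1)) := by
  classical
  -- `Y` is filled up fractionally to measure exactly `θ`, because `lam` may be negative.
  obtain ⟨c, hc0, hc1, hc⟩ : ∃ c : ℝ, 0 ≤ c ∧ c ≤ 1 ∧
      (∑ v ∈ Y, p v) + c * (1 - ∑ v ∈ Y, p v) = θ := by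
    rcases eq_or_lt_of_le (hY.trans hθ) with h | h
    · exact ⟨0, le_rfl, zero_le_one, by linarith⟩
    · have h' : 0 < 1 - ∑ v ∈ Y, p v := by linarith
      refine ⟨(θ - ∑ v ∈ Y, p v) / (1 - ∑ v ∈ Y, p v), div_nonneg (by linarith) h'.le,
        (div_le_one h').2 (by linarith), ?_⟩
      rw [div_mul_cancel₀ _ h'.ne']; ring
  set y : V → ℝ := fun v => if v ∈ Y then 1 else c with hy
  have hy0 : ∀ v, 0 ≤ y v := fun v => by simp only [hy]; split_ifs <;> linarith
  have hy1 : ∀ v, y v ≤ 1 := fun v => by simp only [hy]; split_ifs <;> linarith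
  have hcompl : ∑ v ∈ Yᶜ, p v = 1 - ∑ v ∈ Y, p v := by
    rw [← hp1, ← Finset.sum_add_sum_compl Y]; ring
  have hsum : ∑ v, p v * y v = θ := by
    rw [← Finset.sum_add_sum_compl Y, ← hc, ← hcompl, Finset.mul_sum]
    congr 1
    · exact Finset.sum_congr rfl fun v hv => by simp [hy, hv]
    · exact Finset.sum_congr rfl fun v hv => by simp [hy, Finset.mem_compl.1 hv, mul_comm]
  calc ∑ v ∈ Y, p v * X v = ∑ v ∈ Y, p v * y v * X v :=
        Finset.sum_congr rfl fun v hv => by simp [hy, hv]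
    _ ≤ ∑ v, p v * y v * X v :=
        Finset.sum_le_sum_of_subset_of_nonneg (Finset.subset_univ _) fun v _ _ =>
          mul_nonneg (mul_nonneg (hp v) (hy0 v)) (hX v)
    _ ≤ ∑ v, (lam * (p v * y v) + p v * (s⁻¹ * Real.exp (s * (X v - lam) - 1))) := by
        refine Finset.sum_le_sum fun v _ => ?_
        have h1 : X v - lam ≤ s⁻¹ * Real.exp (s * (X v - lam) - 1) := by
          rw [inv_mul_eq_div, le_div_iff₀ hs]
          linarith [Real.add_one_le_exp (s * (X v - lam) - 1)]
        have h2 : 0 ≤ s⁻¹ * Real.exp (s * (X v - lam) - 1) := by positivity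
        have h3 : y v * (X v - lam) ≤ s⁻¹ * Real.exp (s * (X v - lam) - 1) :=
          (mul_le_mul_of_nonneg_left h1 (hy0 v)).trans (mul_le_of_le_one_left h2 (hy1 v))
        nlinarith [mul_le_mul_of_nonneg_left h3 (hp v)]
    _ = _ := by rw [Finset.sum_add_distrib, ← Finset.mul_sum, hsum]

/-- The exponent that the entropy condition makes available for the tilted moment bound. -/
theorem exists_pos_log_lt_of_binEntropy_add_lt_zero {k : ℕ} {θ α β : ℝ} (hθ₀ : 0 < θ)
    (hθ₁ : θ ≤ 1) (hα : 0 < α) (hβ : 1 < β) (hαβ : α * β < 1)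
    (hcond : Real.binEntropy θ + k * θ * (Real.binEntropy (β * α)
        - β * α * Real.log (1 / α) - (1 - β * α) * Real.log (1 / (1 - α))) < 0) :
    ∃ s : ℝ, 0 < s ∧
      θ * (k * Real.log (1 + α * (Real.exp s - 1)) - Real.log θ) < s * (k * (β * θ * α)) := by
  have hα1 : α < 1 := by nlinarith
  have h1 : 0 < 1 - α := by linarith
  have h2 : 0 < 1 - α * β := by linarith
  have hβ0 : 0 < β := by linarith
  have hr : 1 < β * (1 - α) / (1 - α * β) := by rw [lt_div_iff₀ h2]; nlinarith
  -- The exponential tilt that moves the mean of Bernoulli(`α`) to `αβ`.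
  refine ⟨Real.log (β * (1 - α) / (1 - α * β)), Real.log_pos hr, ?_⟩
  rw [Real.exp_log (by linarith)]
  have hM : 1 + α * (β * (1 - α) / (1 - α * β) - 1) = (1 - α) / (1 - α * β) := by
    field_simp; ring
  -- Only the part `θ * log (1 / θ)` of the entropy is needed; the other part is nonnegative.
  have hlog : 0 ≤ (1 - θ) * Real.log (1 - θ)⁻¹ := by
    rcases eq_or_lt_of_le hθ₁ with h | h
    · simp [h]
    · exact mul_nonneg (by linarith)
        (Real.log_nonneg ((one_le_inv₀ (by linarith)).2 (by linarith)))
  rw [hM, Real.log_div h1.ne' h2.ne', Real.log_div (by positivity) h2.ne',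
    Real.log_mul hβ0.ne' h1.ne']
  simp only [Real.binEntropy, one_div, Real.log_inv] at hcond hlog
  rw [mul_comm β α, Real.log_mul hα.ne' hβ0.ne'] at hcond
  nlinarith

/-! ### Well mixed graphs -/

theorem sum_edgeMass {V W I : Type*} [MeasurableSpace V] [Fintype I] (μ : Measure V)
    (nbr : V → I → W) (Y : Finset V) (B : Finset W) :
    ∑ w ∈ B, edgeMass μ nbr Y w =
      ∑ v ∈ Y, μ.real {v} * ∑ i : I, (B : Set W).indicator 1 (nbr v i) := by
  classical
  simp only [edgeMass]
  rw [Finset.sum_comm]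
  refine Finset.sum_congr rfl fun v _ => ?_
  rw [Finset.sum_comm, Finset.mul_sum]
  refine Finset.sum_congr rfl fun i _ => ?_
  simp [Set.indicator_apply, Finset.sum_ite_eq]

/-- Every set of vertices receives almost its expected share of edges, and the edges from a set of
measure at most `θ` to a set of measure at least `α` stay below the proportion `c / α`. -/
structure WellMixed {V W I : Type*} [MeasurableSpace V] [MeasurableSpace W] [Fintype V] [Fintype I]
    (μ : Measure V) (ν : Measure W) (nbr : V → I → W) (θ α η c : ℝ) : Prop where
  lower : ∀ B : Finset W, Fintype.card I * ν.real B ≤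
    ∑ w ∈ B, edgeMass μ nbr Finset.univ w + Fintype.card I * η
  upper : ∀ B : Finset W, α ≤ ν.real B → ∀ Y : Finset V, μ.real (Y : Set V) ≤ θ →
    α * ∑ w ∈ B, edgeMass μ nbr Y w ≤ ν.real B * (Fintype.card I * c)

/-- If the set `B` of exposed vertices had measure above `α`, each of them would receive from `Y`
more than `β * θ` times the minimum of its actual and expected edge mass. By `lower` these minima
sum to almost the expected mass of `B`, which contradicts `upper`. -/
theorem WellMixed.skillsEmerge {V W I : Type*} [MeasurableSpace V] [Fintype V]
    [MeasurableSpace W] [Fintype W] [MeasurableSingletonClass W] [Fintype I] [Nonempty I]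
    {μ : Measure V} {ν : Measure W} [IsProbabilityMeasure ν] {nbr : V → I → W}
    {θ α β η c : ℝ} (hα : 0 < α) (hβθ' : 0 < β * θ) (hη : 0 < η) (hc : c + β * θ * η ≤ β * θ * α)
    (h : WellMixed μ ν nbr θ α η c) : SkillsEmerge μ ν nbr θ α β := by
  classical
  intro Y hY
  by_contra! hlow
  have hβθ := hβθ'.le
  set n : ℝ := (Fintype.card I : ℝ) with hn
  have hn0 : 0 < n := Nat.cast_pos.2 Fintype.card_pos
  set A := lowExposure μ ν nbr (β * θ) Y with hA
  set B : Finset W := (Aᶜ).toFinset with hB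
  have hBA : (B : Set W) = Aᶜ := by simp [hB]
  have hνB : α < ν.real B := by
    rw [hBA, probReal_compl_eq_one_sub (Set.toFinite A).measurableSet]; linarith
  -- On `B'` the minimum is the actual mass, so `lower` for `B'` controls the whole deficit.
  set B' := B.filter fun w => edgeMass μ nbr Finset.univ w < n * ν.real {w} with hB'
  have h1 : ∀ w ∈ B, β * θ * (if edgeMass μ nbr Finset.univ w < n * ν.real {w} then
      edgeMass μ nbr Finset.univ w else n * ν.real {w}) ≤ edgeMass μ nbr Y w := by
    intro w hw
    have hw' : w ∉ A := by rw [← Set.mem_compl_iff, ← hBA]; exact hw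
    simp only [hA, lowExposure, Set.mem_ofPred_eq, not_and_or, not_le] at hw'
    split_ifs with hlt
    · rcases hw' with hw' | hw'
      · exact hw'.le
      · exact (mul_le_mul_of_nonneg_left hlt.le hβθ).trans hw'.le
    · rcases hw' with hw' | hw'
      · exact (mul_le_mul_of_nonneg_left (not_lt.1 hlt) hβθ).trans hw'.le
      · exact hw'.le
  have h2 := Finset.sum_le_sum h1
  rw [← Finset.mul_sum, Finset.sum_ite, ← hB'] at h2
  have hsplit : ν.real B = ∑ w ∈ B', ν.real {w} +
      ∑ w ∈ B.filter fun w => ¬ edgeMass μ nbr Finset.univ w < n * ν.real {w}, ν.real {w} := by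
    rw [Finset.sum_filter_add_sum_filter_not, sum_measureReal_singleton]
  have h3 := h.lower B'
  rw [← sum_measureReal_singleton B'] at h3
  have h4 := h.upper B hνB.le Y hY
  rw [← Finset.mul_sum] at h2
  have h5 : β * θ * (n * ν.real B - n * η) ≤ ∑ w ∈ B, edgeMass μ nbr Y w := by
    refine le_trans (mul_le_mul_of_nonneg_left ?_ hβθ) h2
    rw [hsplit]
    linarith
  have h6 : α * (β * θ * (ν.real B - η)) ≤ ν.real B * c := by
    have := (mul_le_mul_of_nonneg_left h5 hα.le).trans h4
    have h' : n * (α * (β * θ * (ν.real B - η))) ≤ n * (ν.real B * c) := by linarith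
    exact le_of_mul_le_mul_left h' hn0
  have h7 : ν.real B * c ≤ ν.real B * (β * θ * α - β * θ * η) :=
    mul_le_mul_of_nonneg_left (by linarith) measureReal_nonneg
  nlinarith [mul_pos (mul_pos hβθ' hη) (sub_pos.2 hνB)]

/-! ### Random graphs are well mixed -/

theorem Real.exp_mul_le_one_add_mul {s x : ℝ} (h0 : 0 ≤ x) (h1 : x ≤ 1) :
    Real.exp (s * x) ≤ 1 + x * (Real.exp s - 1) := by
  have := convexOn_exp.2 (Set.mem_univ 0) (Set.mem_univ s) (sub_nonneg.2 h1) h0 (by ring)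
  simp only [smul_eq_mul, mul_zero, zero_add, Real.exp_zero, mul_one] at this
  rw [mul_comm]
  linarith

theorem integral_sum_indicator_one {W : Type*} [Finite W] [MeasurableSpace W]
    [MeasurableSingletonClass W] (ν : Measure W) [IsProbabilityMeasure ν] (k : ℕ) (B : Set W) :
    ∫ x : Fin k → W, ∑ i, B.indicator (1 : W → ℝ) (x i) ∂(Measure.pi fun _ => ν) =
      k * ν.real B := by
  rw [integral_finsetSum _ fun i _ => Integrable.of_finite]
  have : ∀ i : Fin k, ∫ x : Fin k → W, B.indicator (1 : W → ℝ) (x i)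
      ∂(Measure.pi fun _ => ν) = ν.real B := by
    intro i
    have hm := measurePreserving_eval (fun _ : Fin k => ν) i
    have h := integral_map (μ := Measure.pi fun _ : Fin k => ν) hm.measurable.aemeasurable
      (f := B.indicator (1 : W → ℝ)) (measurable_of_finite _).aestronglyMeasurable
    rw [hm.map_eq, integral_indicator_one (Set.toFinite B).measurableSet] at h
    exact h.symm
  simp [this]

theorem integral_exp_mul_sum_indicator_le {W : Type*} [Finite W] [MeasurableSpace W]
    [MeasurableSingletonClass W] (ν : Measure W) [IsProbabilityMeasure ν] (k : ℕ) (B : Set W)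
    {a s : ℝ} (ha0 : 0 ≤ a) (ha1 : a ≤ 1) :
    ∫ x : Fin k → W, Real.exp (s * (a * ∑ i, B.indicator (1 : W → ℝ) (x i)))
      ∂(Measure.pi fun _ => ν) ≤ (1 + a * ν.real B * (Real.exp s - 1)) ^ k := by
  classical
  have hexp : ∀ x : Fin k → W, Real.exp (s * (a * ∑ i, B.indicator (1 : W → ℝ) (x i))) =
      ∏ i, Real.exp (s * (a * B.indicator (1 : W → ℝ) (x i))) := fun x => by
    rw [← Real.exp_sum, Finset.mul_sum, Finset.mul_sum]
  simp_rw [hexp]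
  rw [integral_fintype_prod_eq_pow (fun w => Real.exp (s * (a * B.indicator (1 : W → ℝ) w))),
    Fintype.card_fin]
  refine pow_le_pow_left₀ (integral_nonneg fun _ => (Real.exp_pos _).le) ?_ k
  calc ∫ w, Real.exp (s * (a * B.indicator (1 : W → ℝ) w)) ∂ν
      ≤ ∫ w, (1 + a * (Real.exp s - 1) * B.indicator (1 : W → ℝ) w) ∂ν := by
        refine integral_mono Integrable.of_finite Integrable.of_finite fun w => ?_
        by_cases hw : w ∈ B
        · simpa [hw] using Real.exp_mul_le_one_add_mul (s := s) ha0 ha1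
        · simp [hw]
    _ = 1 + a * ν.real B * (Real.exp s - 1) := by
        rw [integral_add Integrable.of_finite Integrable.of_finite, integral_const_mul,
          integral_indicator_one (Set.toFinite B).measurableSet]
        simp
        ring

theorem sum_indicator_one_mem_Icc {W : Type*} {k : ℕ} (B : Set W) (x : Fin k → W) :
    ∑ i, B.indicator (1 : W → ℝ) (x i) ∈ Set.Icc (0 : ℝ) k := by
  refine ⟨Finset.sum_nonneg fun i _ => Set.indicator_nonneg (fun _ _ => zero_le_one) _, ?_⟩
  calc ∑ i, B.indicator (1 : W → ℝ) (x i) ≤ ∑ _i : Fin k, (1 : ℝ) :=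
        Finset.sum_le_sum fun i _ => Set.indicator_le_self' (fun _ _ => zero_le_one) _
    _ = k := by simp

instance isProbabilityMeasure_skillGraphLaw {S : Type*} [MeasurableSpace S] (T : Type*) [Fintype T]
    (k : ℕ) (μ₁ : Measure S) [IsProbabilityMeasure μ₁] :
    IsProbabilityMeasure (skillGraphLaw T k μ₁) := by
  unfold skillGraphLaw; infer_instance

/-- The lower bound of `WellMixed`, in probability. -/
theorem exists_measureReal_lower_fails_le {k : ℕ} (hk : 0 < k) {η ε : ℝ} (hη : 0 < η)
    (hε : 0 < ε) :
    ∃ δ : ℝ, 0 < δ ∧ ∀ (V W : Type*) [Fintype V] [MeasurableSpace V] [MeasurableSingletonClass V]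
      [Fintype W] [MeasurableSpace W] [MeasurableSingletonClass W]
      (μ : Measure V) [IsProbabilityMeasure μ] (ν : Measure W) [IsProbabilityMeasure ν],
      (∀ v, Fintype.card W * μ.real {v} ≤ δ) →
      (skillGraphLaw V k ν).real {G | ∀ B : Finset W, k * ν.real B ≤
        ∑ w ∈ B, edgeMass μ G Finset.univ w + k * η}ᶜ ≤ ε := by
  classical
  have hk0 : (0 : ℝ) < k := Nat.cast_pos.2 hk
  obtain ⟨δ, hδ, h⟩ := exists_measureReal_iUnion_le (C := k) (τ := k * η) hk0
    (mul_pos hk0 hη) hε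
  refine ⟨δ, hδ, ?_⟩
  intro V W _ _ _ _ _ _ μ _ ν _ hμ
  have : Nonempty W := nonempty_of_isProbabilityMeasure ν
  have hp1 : ∑ v, μ.real {v} = 1 := by rw [sum_measureReal_singleton]; simp
  -- A deficit of edges into `B` is an excess into its complement, since every vertex has exactly
  -- `k` edges; the upper deviation bound therefore suffices.
  refine le_trans (measureReal_mono ?_) (h (Measure.pi fun _ : Fin k => ν)
    (fun (B : Finset W) x => ∑ i, ((B : Set W)ᶜ).indicator 1 (x i))
    (fun B => measurable_of_finite _) (fun B x => sum_indicator_one_mem_Icc _ x)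
    (fun v => μ.real {v}) (fun v => measureReal_nonneg) hp1 hμ)
  intro G hG
  simp only [Set.mem_compl_iff, Set.mem_ofPred_eq, not_forall, not_le] at hG
  obtain ⟨B, hB⟩ := hG
  refine Set.mem_iUnion.2 ⟨B, ?_⟩
  have hx : ∀ v, ∑ i, ((B : Set W)ᶜ).indicator (1 : W → ℝ) (G v i) =
      k - ∑ i, (B : Set W).indicator (1 : W → ℝ) (G v i) := by
    intro v
    rw [Set.indicator_compl]
    simp
  simp only [Set.mem_ofPred_eq, integral_sum_indicator_one, hx]
  rw [probReal_compl_eq_one_sub (Set.toFinite _).measurableSet]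
  rw [sum_edgeMass] at hB
  simp only [mul_sub, Finset.sum_sub_distrib, ← Finset.sum_mul, hp1]
  linarith

/-- The upper bound of `WellMixed`, in probability. -/
theorem exists_measureReal_upper_fails_le {k : ℕ} {θ α s b τ ε : ℝ}
    (hθ₀ : 0 < θ) (hθ₁ : θ ≤ 1) (hα : 0 < α) (hs : 0 < s)
    (hb : θ * (k * Real.log (1 + α * (Real.exp s - 1)) - Real.log θ) ≤ s * b)
    (hτ : 0 < τ) (hε : 0 < ε) :
    ∃ δ : ℝ, 0 < δ ∧ ∀ (V W : Type*) [Fintype V] [MeasurableSpace V] [MeasurableSingletonClass V]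
      [Fintype W] [MeasurableSpace W] [MeasurableSingletonClass W]
      (μ : Measure V) [IsProbabilityMeasure μ] (ν : Measure W) [IsProbabilityMeasure ν],
      (∀ v, Fintype.card W * μ.real {v} ≤ δ) →
      (skillGraphLaw V k ν).real {G | ∀ B : Finset W, α ≤ ν.real B → ∀ Y : Finset V,
        μ.real (Y : Set V) ≤ θ →
        α * ∑ w ∈ B, edgeMass μ G Y w ≤ ν.real B * (b + τ)}ᶜ ≤ ε := by
  classical
  set M := 1 + α * (Real.exp s - 1) with hM
  have hM0 : 0 < M := by nlinarith [Real.add_one_le_exp s]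
  -- The minimiser of `lam * θ + s⁻¹ * exp (-(s * lam + 1)) * M ^ k`; there the second term equals
  -- `θ / s`.
  obtain ⟨lam, hlam⟩ : ∃ lam : ℝ, s * lam + 1 = k * Real.log M - Real.log θ :=
    ⟨s⁻¹ * (k * Real.log M - Real.log θ - 1), by field_simp; ring⟩
  have hexp : Real.exp (-(s * lam + 1)) * M ^ k = θ := by
    rw [hlam, ← Real.rpow_natCast, Real.rpow_def_of_pos hM0, ← Real.exp_add]
    rw [show -(k * Real.log M - Real.log θ) + Real.log M * k = Real.log θ by ring,
      Real.exp_log hθ₀]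
  obtain ⟨δ, hδ, h⟩ := exists_measureReal_iUnion_le
    (C := s⁻¹ * Real.exp (s * (k - lam) - 1)) (τ := τ) (by positivity) hτ hε
  refine ⟨δ, hδ, ?_⟩
  intro V W _ _ _ _ _ _ μ _ ν _ hμ
  have : Nonempty W := nonempty_of_isProbabilityMeasure ν
  have hp1 : ∑ v, μ.real {v} = 1 := by rw [sum_measureReal_singleton]; simp
  -- After this scaling the moment bound is `M ^ k` for all `B` of measure at least `α`, however
  -- much larger than `α`.
  set X : Finset W → (Fin k → W) → ℝ := fun B x =>
    α / ν.real B * ∑ i, (B : Set W).indicator 1 (x i) with hX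
  have hXI : ∀ B : Finset W, α ≤ ν.real B → ∀ x, X B x ∈ Set.Icc (0 : ℝ) k := by
    intro B hB x
    have h1 := sum_indicator_one_mem_Icc (B : Set W) x
    have h2 : 0 ≤ α / ν.real B := div_nonneg hα.le measureReal_nonneg
    have h3 : α / ν.real B ≤ 1 := (div_le_one (hα.trans_le hB)).2 hB
    exact ⟨mul_nonneg h2 h1.1, (mul_le_of_le_one_left h1.1 h3).trans h1.2⟩
  refine le_trans (measureReal_mono ?_) (h (Measure.pi fun _ : Fin k => ν)
    (fun (B : Finset W) x => if α ≤ ν.real B then s⁻¹ * Real.exp (s * (X B x - lam) - 1) else 0)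
    (fun B => measurable_of_finite _) ?_
    (fun v => μ.real {v}) (fun v => measureReal_nonneg) hp1 hμ)
  · intro G hG
    simp only [Set.mem_compl_iff, Set.mem_ofPred_eq, not_forall, not_le] at hG
    obtain ⟨B, hB, Y, hY, hlt⟩ := hG
    refine Set.mem_iUnion.2 ⟨B, ?_⟩
    have hν : 0 < ν.real B := hα.trans_le hB
    simp only [Set.mem_ofPred_eq, if_pos hB]
    rw [← sum_measureReal_singleton] at hY
    have key := sum_mul_le_add_sum_exp (p := fun v => μ.real {v}) (X := fun v => X B (G v))
      (fun v => measureReal_nonneg) hp1 (fun v => (hXI B hB _).1) lam hθ₁ hs hY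
    have hleft : ∑ v ∈ Y, μ.real {v} * X B (G v) =
        α * (∑ w ∈ B, edgeMass μ G Y w) / ν.real B := by
      rw [sum_edgeMass, Finset.mul_sum, Finset.sum_div]
      exact Finset.sum_congr rfl fun v _ => by simp only [hX]; ring
    rw [hleft] at key
    have h1 : b + τ < α * (∑ w ∈ B, edgeMass μ G Y w) / ν.real B := by
      rw [lt_div_iff₀ hν]; linarith
    have hE : ∫ x, s⁻¹ * Real.exp (s * (X B x - lam) - 1) ∂(Measure.pi fun _ : Fin k => ν) ≤
        s⁻¹ * θ := by
      have hfun : ∀ x : Fin k → W, s⁻¹ * Real.exp (s * (X B x - lam) - 1) =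
          s⁻¹ * Real.exp (-(s * lam + 1)) * Real.exp (s * X B x) := by
        intro x
        rw [mul_assoc, ← Real.exp_add]
        ring_nf
      simp_rw [hfun]
      rw [integral_const_mul, mul_assoc]
      refine mul_le_mul_of_nonneg_left ?_ (inv_nonneg.2 hs.le)
      rw [← hexp]
      refine mul_le_mul_of_nonneg_left ?_ (Real.exp_pos _).le
      refine (integral_exp_mul_sum_indicator_le ν k (B : Set W)
        (div_nonneg hα.le hν.le) ((div_le_one hν).2 hB)).trans (le_of_eq ?_)
      rw [div_mul_cancel₀ _ hν.ne']
    have hlt' : lam * θ + s⁻¹ * θ ≤ b := by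
      have : θ * (s * lam + 1) ≤ s * b := hlam ▸ hb
      rw [show lam * θ + s⁻¹ * θ = s⁻¹ * (θ * (s * lam + 1)) by field_simp,
        inv_mul_le_iff₀ hs]
      exact this
    linarith
  · intro B x
    split_ifs with hB
    · refine ⟨by positivity, ?_⟩
      gcongr
      exact (hXI B hB x).2
    · exact ⟨le_rfl, by positivity⟩

/-- A random skill graph is well mixed with high probability. -/
theorem exists_wellMixed {k : ℕ} (hk : 0 < k) {θ α β : ℝ} (hθ₀ : 0 < θ)
    (hθ₁ : θ ≤ 1) (hα : 0 < α) (hβ : 1 < β) (hαβ : α * β < 1)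
    (hcond : Real.binEntropy θ + k * θ * (Real.binEntropy (β * α)
        - β * α * Real.log (1 / α) - (1 - β * α) * Real.log (1 / (1 - α))) < 0) :
    ∃ η c : ℝ, 0 < η ∧ c + β * θ * η ≤ β * θ * α ∧ ∀ ε : ℝ, 0 < ε → ∃ δ : ℝ, 0 < δ ∧
      ∀ (V W : Type*) [Fintype V] [MeasurableSpace V] [MeasurableSingletonClass V]
      [Fintype W] [MeasurableSpace W] [MeasurableSingletonClass W]
      (μ : Measure V) [IsProbabilityMeasure μ] (ν : Measure W) [IsProbabilityMeasure ν],
      (∀ v, Fintype.card W * μ.real {v} ≤ δ) →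
      (skillGraphLaw V k ν).real {G | WellMixed μ ν G θ α η c}ᶜ ≤ ε := by
  have hk0 : (0 : ℝ) < k := Nat.cast_pos.2 hk
  have hβθ : 0 < β * θ := mul_pos (by linarith) hθ₀
  obtain ⟨s, hs, hlt⟩ := exists_pos_log_lt_of_binEntropy_add_lt_zero hθ₀ hθ₁ hα hβ hαβ hcond
  set b := s⁻¹ * (θ * (k * Real.log (1 + α * (Real.exp s - 1)) - Real.log θ)) with hb
  have hbs : θ * (k * Real.log (1 + α * (Real.exp s - 1)) - Real.log θ) = s * b := by
    rw [hb, mul_inv_cancel_left₀ hs.ne']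
  rw [hbs] at hlt
  have hlt' : b < k * (β * θ * α) := lt_of_mul_lt_mul_left hlt hs.le
  -- Half of the gap goes to the upper deviation, through `c`, and half to the lower one, through
  -- `η`; then `c + β * θ * η` is exactly `β * θ * α`.
  set τ := (k * (β * θ * α) - b) / 2 with hτ
  have hτ0 : 0 < τ := by rw [hτ]; linarith
  refine ⟨τ / k / (β * θ), (b + τ) / k, by positivity, ?_, ?_⟩
  · rw [mul_div_cancel₀ _ hβθ.ne', ← add_div, div_le_iff₀ hk0]
    linarith
  intro ε hε
  obtain ⟨δ₁, hδ₁, h₁⟩ := exists_measureReal_lower_fails_le hk (η := τ / k / (β * θ))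
    (by positivity) (half_pos hε)
  obtain ⟨δ₂, hδ₂, h₂⟩ := exists_measureReal_upper_fails_le (k := k) hθ₀ hθ₁ hα hs hbs.le hτ0
    (half_pos hε)
  refine ⟨min δ₁ δ₂, lt_min hδ₁ hδ₂, ?_⟩
  intro V W _ _ _ _ _ _ μ _ ν _ hμ
  have e₁ := h₁ V W μ ν fun v => (hμ v).trans (min_le_left _ _)
  have e₂ := h₂ V W μ ν fun v => (hμ v).trans (min_le_right _ _)
  refine (measureReal_mono ?_).trans ((measureReal_union_le _ _).trans
    ((add_le_add e₁ e₂).trans (add_halves ε).le))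
  · rw [← Set.compl_inter]
    refine Set.compl_subset_compl.2 fun G hG => ⟨?_, ?_⟩
    · simpa only [Fintype.card_fin, Set.mem_ofPred_eq] using hG.1
    · simpa only [Fintype.card_fin, mul_div_cancel₀ _ hk0.ne', Set.mem_ofPred_eq] using hG.2

/-! ### Recombination and tuples of skills -/

theorem groupedTuples_eq_iff {S T : Type*} {m k k' : ℕ} (e : T ≃ Fin m × Fin k')
    (g : Fin k × Fin k' ≃ Fin k' × Fin k) (G : T → Fin k → S) (y : Fin m → Fin k → Fin k' → S) :
    groupedTuples e g G = y ↔
      G = fun t i => y (e t).1 (g.symm ((e t).2, i)).1 (g.symm ((e t).2, i)).2 := by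
  constructor
  · rintro rfl
    funext t i
    simp [groupedTuples, pieceSkills]
  · rintro rfl
    funext p i j
    simp [groupedTuples, pieceSkills]

/-- As `e` and `g` are bijections, every draw is used exactly once, so grouping only relabels the
coordinates of a product measure. -/
theorem map_groupedTuples_skillGraphLaw {S T : Type*} [Fintype S] [MeasurableSpace S]
    [MeasurableSingletonClass S] [Fintype T] {m k k' : ℕ} (μ₁ : Measure S)
    [IsProbabilityMeasure μ₁] (e : T ≃ Fin m × Fin k') (g : Fin k × Fin k' ≃ Fin k' × Fin k) :
    (skillGraphLaw T k μ₁).map (groupedTuples e g) =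
      skillGraphLaw (Fin m) k (Measure.pi fun _ : Fin k' => μ₁) := by
  refine Measure.ext_of_singleton fun y => ?_
  rw [Measure.map_apply (measurable_of_finite _) (measurableSet_singleton y)]
  have hpre : groupedTuples e g ⁻¹' {y} =
      {fun t i => y (e t).1 (g.symm ((e t).2, i)).1 (g.symm ((e t).2, i)).2} := by
    ext G
    simp only [Set.mem_preimage, Set.mem_singleton_iff, groupedTuples_eq_iff]
  rw [hpre]
  simp only [skillGraphLaw, Measure.pi_singleton]
  rw [Fintype.prod_equiv e _ (fun a : Fin m × Fin k' =>
      ∏ i : Fin k, μ₁ {y a.1 (g.symm (a.2, i)).1 (g.symm (a.2, i)).2}) fun _ => rfl,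
    Fintype.prod_prod_type]
  refine Finset.prod_congr rfl fun p _ => ?_
  rw [← Fintype.prod_prod_type' fun a i => μ₁ {y p (g.symm (a, i)).1 (g.symm (a, i)).2},
    ← Fintype.prod_prod_type' fun i j => μ₁ {y p i j}]
  exact Fintype.prod_equiv g.symm _ _ fun _ => rfl

theorem isProbabilityMeasure_pieceMeasure {T : Type*} [Finite T] [MeasurableSpace T]
    [MeasurableSingletonClass T] {m k' : ℕ} (e : T ≃ Fin m × Fin k') (μ₂ : Measure T)
    [IsProbabilityMeasure μ₂] : IsProbabilityMeasure (pieceMeasure e μ₂) :=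
  Measure.isProbabilityMeasure_map (measurable_of_finite _).aemeasurable

theorem pieceMeasure_real_singleton_le {T : Type*} [Finite T] [MeasurableSpace T]
    [MeasurableSingletonClass T] {m k' : ℕ} (e : T ≃ Fin m × Fin k') (μ₂ : Measure T)
    [IsProbabilityMeasure μ₂] {q : ℝ} (hq : ∀ t, μ₂.real {t} ≤ q) (p : Fin m) :
    (pieceMeasure e μ₂).real {p} ≤ k' * q := by
  classical
  have hset : (fun t => (e t).1) ⁻¹' {p} =
      ((Finset.univ.image fun j => e.symm (p, j) : Finset T) : Set T) := by
    ext t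
    simp only [Set.mem_preimage, Set.mem_singleton_iff, Finset.coe_image, Finset.coe_univ,
      Set.image_univ, Set.mem_range]
    constructor
    · rintro rfl
      exact ⟨(e t).2, by simp⟩
    · rintro ⟨j, rfl⟩
      simp
  rw [pieceMeasure, map_measureReal_apply (measurable_of_finite _) (measurableSet_singleton p),
    hset, ← sum_measureReal_singleton, Finset.sum_image fun a _ b _ h => by simpa using h]
  calc ∑ j : Fin k', μ₂.real {e.symm (p, j)} ≤ ∑ _j : Fin k', q :=
        Finset.sum_le_sum fun j _ => hq _
    _ = k' * q := by simp

/-- An average of well mixed graphs is well mixed. -/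
theorem WellMixed.of_average {V W I J K : Type*} [MeasurableSpace V] [MeasurableSpace W]
    [Fintype V] [Fintype I] [Fintype J] [Fintype K] {μ : Measure V} {ν : Measure W}
    {nbr : K → V → I → W} {nbr' : V → J → W} {θ α η c : ℝ} {N : ℝ} (hN : 0 < N)
    (hcard : (Fintype.card K * Fintype.card I : ℝ) = N * Fintype.card J)
    (havg : ∀ v (φ : W → ℝ), ∑ κ, ∑ i, φ (nbr κ v i) = N * ∑ j, φ (nbr' v j))
    (h : ∀ κ, WellMixed μ ν (nbr κ) θ α η c) : WellMixed μ ν nbr' θ α η c := by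
  classical
  have hmass : ∀ (Y : Finset V) (B : Finset W), ∑ κ, ∑ w ∈ B, edgeMass μ (nbr κ) Y w =
      N * ∑ w ∈ B, edgeMass μ nbr' Y w := by
    intro Y B
    simp_rw [sum_edgeMass]
    rw [Finset.sum_comm, Finset.mul_sum]
    refine Finset.sum_congr rfl fun v _ => ?_
    rw [← Finset.mul_sum, havg v]
    ring
  constructor
  · intro B
    have h1 := Finset.sum_le_sum fun κ (_ : κ ∈ Finset.univ) => (h κ).lower B
    rw [Finset.sum_add_distrib, hmass] at h1
    simp only [Finset.sum_const, Finset.card_univ, nsmul_eq_mul] at h1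
    rw [← mul_assoc, ← mul_assoc, hcard] at h1
    refine le_of_mul_le_mul_left ?_ hN
    linarith
  · intro B hB Y hY
    have h1 := Finset.sum_le_sum fun κ (_ : κ ∈ Finset.univ) => (h κ).upper B hB Y hY
    rw [← Finset.mul_sum, hmass] at h1
    simp only [Finset.sum_const, Finset.card_univ, nsmul_eq_mul] at h1
    refine le_of_mul_le_mul_left ?_ hN
    have h2 : (Fintype.card K : ℝ) * (ν.real B * (Fintype.card I * c)) =
        N * (ν.real B * (Fintype.card J * c)) := by
      linear_combination ν.real B * c * hcard
    linarith

theorem exists_perm_apply_eq {ι A : Type*} [Finite A] (f f' : ι ↪ A) :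
    ∃ σ : Equiv.Perm A, ∀ j, σ (f j) = f' j := by
  classical
  let q : {x // x ∈ Set.range f} ≃ {x // x ∈ Set.range f'} :=
    (Equiv.ofInjective f f.injective).symm.trans (Equiv.ofInjective f' f'.injective)
  refine ⟨q.extendSubtype, fun j => ?_⟩
  rw [q.extendSubtype_apply_of_mem _ ⟨j, rfl⟩]
  simp [q, Equiv.ofInjective_symm_apply]

/-- The tuple of positions in row `i` of an arrangement. -/
def arrangementRow {I J A : Type*} (g : I × J ≃ A) (i : I) : J ↪ A :=
  ⟨fun j => g (i, j), fun a b h => by simpa using h⟩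

/-- Composition with a permutation of the positions that carries `f` to `f'` matches the two fibers.
-/
theorem card_arrangementRow_fiber {I J A : Type*} [Fintype I] [Fintype J] [Fintype A]
    [DecidableEq I] [DecidableEq J] [DecidableEq A] (f f' : J ↪ A) :
    (Finset.univ.filter fun x : (I × J ≃ A) × I => arrangementRow x.1 x.2 = f).card =
      (Finset.univ.filter fun x : (I × J ≃ A) × I => arrangementRow x.1 x.2 = f').card := by
  obtain ⟨σ, hσ⟩ := exists_perm_apply_eq f f'
  refine Finset.card_bij' (fun x _ => (x.1.trans σ, x.2)) (fun x _ => (x.1.trans σ.symm, x.2))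
    ?_ ?_ ?_ ?_
  · intro x hx
    simp only [Finset.mem_filter, Finset.mem_univ, true_and] at hx ⊢
    ext j
    rw [← hσ j, ← hx]
    rfl
  · intro x hx
    simp only [Finset.mem_filter, Finset.mem_univ, true_and] at hx ⊢
    ext j
    rw [← σ.symm_apply_apply (f j), hσ j, ← hx]
    rfl
  · intro x _
    simp [Equiv.trans_assoc]
  · intro x _
    simp [Equiv.trans_assoc]

theorem exists_sum_arrangementRow_eq {I J A : Type*} [Fintype I] [Fintype J] [Fintype A]
    [DecidableEq I] [DecidableEq J] [DecidableEq A] [Nonempty I] (g₀ : I × J ≃ A) :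
    ∃ N : ℝ, 0 < N ∧ ∀ φ : (J ↪ A) → ℝ,
      ∑ g : I × J ≃ A, ∑ i, φ (arrangementRow g i) = N * ∑ f, φ f := by
  obtain ⟨i₀⟩ := ‹Nonempty I›
  refine ⟨(Finset.univ.filter fun x : (I × J ≃ A) × I =>
    arrangementRow x.1 x.2 = arrangementRow g₀ i₀).card, ?_, fun φ => ?_⟩
  · exact Nat.cast_pos.2 (Finset.card_pos.2 ⟨(g₀, i₀), by simp⟩)
  · rw [← Fintype.sum_prod_type' fun (g : I × J ≃ A) i => φ (arrangementRow g i),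
      ← Finset.sum_fiberwise Finset.univ (fun x : (I × J ≃ A) × I => arrangementRow x.1 x.2),
      Finset.mul_sum]
    refine Finset.sum_congr rfl fun f _ => ?_
    rw [Finset.sum_congr rfl (g := fun _ => φ f) fun x hx => by
        rw [(Finset.mem_filter.1 hx).2],
      Finset.sum_const, nsmul_eq_mul, card_arrangementRow_fiber f (arrangementRow g₀ i₀)]

/-- Every choice of positions is a row of equally many arrangements, so the used tuples average the
grouped graphs. The inequalities in `WellMixed` are linear in the edge masses and survive averaging.
-/
theorem WellMixed.usedTuples {S T : Type*} [Fintype S] [MeasurableSpace S] {m k k' : ℕ}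
    (hk : 0 < k) {e : T ≃ Fin m × Fin k'} {G : T → Fin k → S} {μ : Measure (Fin m)}
    {ν : Measure (Fin k' → S)} {θ α η c : ℝ}
    (h : ∀ g, WellMixed μ ν (groupedTuples e g G) θ α η c) :
    WellMixed μ ν (usedTuples e G) θ α η c := by
  have : Nonempty (Fin k) := ⟨⟨0, hk⟩⟩
  obtain ⟨N, hN, hsum⟩ := exists_sum_arrangementRow_eq (Equiv.prodComm (Fin k) (Fin k'))
  refine WellMixed.of_average (nbr := fun g => groupedTuples e g G) hN ?_ ?_ h
  · simpa using hsum fun _ => 1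
  · exact fun p φ => hsum fun f => φ (_root_.usedTuples e G p f)

/-! ### Emergence of skills and tuples -/

theorem mainTheorem1 (k : ℕ) (hk : 0 < k) (θ α β : ℝ) (hθ₀ : 0 ≤ θ) (hθ₁ : θ ≤ 1)
    (hα : 0 < α) (hβ : 1 < β) (hαβ : α * β < 1)
    (hcond : Real.binEntropy θ + k * θ * (Real.binEntropy (β * α)
        - β * α * Real.log (1 / α) - (1 - β * α) * Real.log (1 / (1 - α))) < 0) :
    -- skills
    (∀ ε : ℝ, 0 < ε → ∃ δ : ℝ, 0 < δ ∧
      ∀ (S T : Type*) [Fintype S] [MeasurableSpace S] [MeasurableSingletonClass S]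
        [Fintype T] [MeasurableSpace T] [MeasurableSingletonClass T]
        (μ₁ : Measure S) [IsProbabilityMeasure μ₁] (μ₂ : Measure T) [IsProbabilityMeasure μ₂],
        (∀ t : T, Fintype.card S * μ₂.real {t} ≤ δ) →
        1 - ε ≤ (skillGraphLaw T k μ₁).real {G | SkillsEmerge μ₂ μ₁ G θ α β}) ∧
    -- tuples of skills
    (∀ k' : ℕ, 0 < k' → ∀ ε : ℝ, 0 < ε → ∃ δ : ℝ, 0 < δ ∧
      ∀ (S T : Type*) [Fintype S] [MeasurableSpace S] [MeasurableSingletonClass S]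
        [Fintype T] [MeasurableSpace T] [MeasurableSingletonClass T]
        (μ₁ : Measure S) [IsProbabilityMeasure μ₁] (μ₂ : Measure T) [IsProbabilityMeasure μ₂]
        (m : ℕ) (e : T ≃ Fin m × Fin k'),
        (∀ t : T, (Fintype.card S : ℝ) ^ k' * μ₂.real {t} ≤ δ) →
        1 - ε ≤ (skillGraphLaw T k μ₁).real {G |
          (∀ g : Fin k × Fin k' ≃ Fin k' × Fin k,
            SkillsEmerge (pieceMeasure e μ₂) (Measure.pi fun _ : Fin k' => μ₁)
              (groupedTuples e g G) θ α β) ∧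
          SkillsEmerge (pieceMeasure e μ₂) (Measure.pi fun _ : Fin k' => μ₁)
            (usedTuples e G) θ α β}) := by
  -- At `θ = 0` the entropy condition would read `0 < 0`.
  have hθ : 0 < θ := hθ₀.lt_of_ne (by rintro rfl; simp at hcond)
  have hβθ : 0 < β * θ := mul_pos (by linarith) hθ
  have : Nonempty (Fin k) := ⟨⟨0, hk⟩⟩
  constructor
  · intro ε hε
    obtain ⟨η, c, hη, hc, hmix⟩ := exists_wellMixed hk hθ hθ₁ hα hβ hαβ hcond
    obtain ⟨δ, hδ, h⟩ := hmix ε hε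
    refine ⟨δ, hδ, ?_⟩
    intro S T _ _ _ _ _ _ μ₁ _ μ₂ _ hμ
    have h1 := h T S μ₂ μ₁ hμ
    rw [probReal_compl_eq_one_sub (Set.toFinite _).measurableSet, sub_le_comm] at h1
    exact h1.trans (measureReal_mono fun G hG => WellMixed.skillsEmerge hα hβθ hη hc hG)
  · intro k' hk' ε hε
    obtain ⟨η, c, hη, hc, hmix⟩ := exists_wellMixed hk hθ hθ₁ hα hβ hαβ hcond
    set Γ : ℝ := (Fintype.card (Fin k × Fin k' ≃ Fin k' × Fin k) : ℝ) with hΓ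
    have hΓ0 : 0 < Γ := Nat.cast_pos.2 (Fintype.card_pos_iff.2 ⟨Equiv.prodComm _ _⟩)
    have hk0 : (0 : ℝ) < k' := Nat.cast_pos.2 hk'
    -- The failure probability is shared among the `Γ` arrangements; the division of `δ` by `k'`
    -- below accounts for the `k'` text pieces in a block.
    obtain ⟨δ, hδ, h⟩ := hmix (ε / Γ) (div_pos hε hΓ0)
    refine ⟨δ / k', div_pos hδ hk0, ?_⟩
    intro S T _ _ _ _ _ _ μ₁ _ μ₂ _ m e hμ
    have := isProbabilityMeasure_pieceMeasure e μ₂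
    have : Nonempty S := nonempty_of_isProbabilityMeasure μ₁
    have hS : (0 : ℝ) < (Fintype.card S : ℝ) ^ k' := pow_pos (Nat.cast_pos.2 Fintype.card_pos) _
    have hpiece : ∀ p, Fintype.card (Fin k' → S) * (pieceMeasure e μ₂).real {p} ≤ δ := by
      intro p
      have h1 := pieceMeasure_real_singleton_le e μ₂
        (fun t => (le_div_iff₀' hS).2 (hμ t)) p
      rw [Fintype.card_fun, Fintype.card_fin, Nat.cast_pow, ← le_div_iff₀' hS]
      refine h1.trans (le_of_eq ?_)
      field_simp
    have h1 := h (Fin m) (Fin k' → S) (pieceMeasure e μ₂) (Measure.pi fun _ => μ₁) hpiece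
    have hbad : (skillGraphLaw T k μ₁).real (⋃ g, groupedTuples e g ⁻¹'
        {G | WellMixed (pieceMeasure e μ₂) (Measure.pi fun _ => μ₁) G θ α η c}ᶜ) ≤ ε := by
      refine (measureReal_iUnion_fintype_le _).trans ?_
      calc _ ≤ ∑ _g : Fin k × Fin k' ≃ Fin k' × Fin k, ε / Γ := by
            refine Finset.sum_le_sum fun g _ => ?_
            rw [← map_measureReal_apply (measurable_of_finite _) (Set.toFinite _).measurableSet,
              map_groupedTuples_skillGraphLaw]
            exact h1
        _ = ε := by
            rw [Finset.sum_const, Finset.card_univ, nsmul_eq_mul, ← hΓ, mul_div_cancel₀ _ hΓ0.ne']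
    have hgood := probReal_compl_eq_one_sub (μ := skillGraphLaw T k μ₁)
      (Set.toFinite (⋃ g, groupedTuples e g ⁻¹'
        {G | WellMixed (pieceMeasure e μ₂) (Measure.pi fun _ => μ₁) G θ α η c}ᶜ)).measurableSet
    refine le_trans (by linarith) (hgood.symm.le.trans (measureReal_mono fun G hG => ?_))
    have hG' : ∀ g, WellMixed (pieceMeasure e μ₂) (Measure.pi fun _ => μ₁)
        (groupedTuples e g G) θ α η c := by
      intro g
      by_contra hg
      exact hG (Set.mem_iUnion.2 ⟨g, hg⟩)
    have : Nonempty (Fin k' ↪ Fin k' × Fin k) :=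
      ⟨arrangementRow (Equiv.prodComm (Fin k) (Fin k')) ⟨0, hk⟩⟩
    exact ⟨fun g => (hG' g).skillsEmerge hα hβθ hη hc,
      (WellMixed.usedTuples hk hG').skillsEmerge hα hβθ hη hc⟩
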